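/- Conventions. Let $p,q$ be positive integers and let $(\breve N,\breve g,\breve J)$ be a locally metallic semi-Riemannian manifold: $\breve g$ is a semi-Riemannian metric with Levi-Civita connection $\breve\nabla$, and $\breve J$ is a smooth $(1,1)$-tensor field with $\breve J^2=p\breve J+qI$, $\breve g(\breve JX,Y)=\breve g(X,\breve JY)$ and $\breve\nabla\breve J=0$. Let $N$ be an immersed lightlike submanifold of $\breve N$: the radical distribution $\mathrm{Rad}(TN)=TN\cap TN^{\perp}$ has constant rank $r\ge 1$, a screen distribution $S(TN)$ (a complement of $\mathrm{Rad}(TN)$ in $TN$), a screen transversal bundle $S(TN^\perp)$ (a complement of $\mathrm{Rad}(TN)$ in $TN^\perp$) and a lightlike transversal bundle $\mathrm{ltr}(TN)$ (totally null, orthogonal to $S(TN)$ and to $S(TN^\perp)$) are fixed, and $T\breve N|_N=TN\oplus \mathrm{ltr}(TN)\oplus S(TN^\perp)$. For $W,U\in\Gamma(TN)$ and $Z\in\Gamma(S(TN^\perp))$, let $\nabla_WU$ and $h^s(W,U)$ be the components of $\breve\nabla_WU$ in $TN$ and in $S(TN^\perp)$, and let $\nabla^s_WZ$ be the component of $\breve\nabla_WZ$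 in $S(TN^\perp)$. Theorem. Suppose that $N$ is a screen transversal anti-invariant lightlike submanifold, that is, $\breve J\,\mathrm{Rad}(TN)\subset S(TN^\perp)$ and $\breve J S(TN)\subset S(TN^\perp)$. (Then $\breve g$ is nondegenerate on $\breve JS(TN)$, and $S(TN^\perp)$ is the orthogonal direct sum of $\breve JS(TN)$ and the orthogonal complement of $\breve JS(TN)$ in $S(TN^\perp)$; components in $\breve JS(TN)$ refer to this decomposition.) Then $\mathrm{Rad}(TN)$ defines a totally geodesic foliation (that is, $\mathrm{Rad}(TN)$ is involutive and $\nabla_WU\in\Gamma(\mathrm{Rad}(TN))$ for all $W,U\in\Gamma(\mathrm{Rad}(TN))$) if and only if $$\nabla^s_W\breve JU-p\,h^s(W,U)$$ has no component in $\breve JS(TN)$, for all $W,U\in\Gamma(\mathrm{Rad}(TN))$. -/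

import Mathlib

open Bundle Manifold
open scoped Manifold ContDiff Topology

noncomputable section

namespace MetallicLightlike

variable {E : Type*} [NormedAddCommGroup E] [NormedSpace ℝ E]
  {F : Type*} [NormedAddCommGroup F] [NormedSpace ℝ F]
  {M : Type*} [TopologicalSpace M] [ChartedSpace E M]
  {N : Type*} [TopologicalSpace N] [ChartedSpace F N]

/-! ### The ambient manifold: semi-Riemannian metrics, Levi-Civita connection, metallic structures -/

/-- A smooth semi-Riemannian metric on `M`: a smooth field of nondegenerate symmetric bilinear
forms on the tangent spaces. -/
structure SemiRiemannianMetric (E : Type*) [NormedAddCommGroup E] [NormedSpace ℝ E]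
    (M : Type*) [TopologicalSpace M] [ChartedSpace E M] [IsManifold 𝓘(ℝ, E) ∞ M] where
  form (x : M) : TangentSpace 𝓘(ℝ, E) x →L[ℝ] TangentSpace 𝓘(ℝ, E) x →L[ℝ] ℝ
  symm (x : M) (v w : TangentSpace 𝓘(ℝ, E) x) : form x v w = form x w v
  nondegenerate (x : M) (v : TangentSpace 𝓘(ℝ, E) x) (hv : ∀ w, form x v w = 0) : v = 0
  smooth : ContMDiff 𝓘(ℝ, E) (𝓘(ℝ, E).prod 𝓘(ℝ, E →L[ℝ] E →L[ℝ] ℝ)) ∞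
    (fun x ↦ TotalSpace.mk' (E →L[ℝ] E →L[ℝ] ℝ) x (form x))

/-- The orthogonal complement of a subspace of a tangent space of `M`. -/
def SemiRiemannianMetric.perp [IsManifold 𝓘(ℝ, E) ∞ M] (g : SemiRiemannianMetric E M) {x : M}
    (D : Submodule ℝ (TangentSpace 𝓘(ℝ, E) x)) : Submodule ℝ (TangentSpace 𝓘(ℝ, E) x) where
  carrier := {v | ∀ w ∈ D, g.form x v w = 0}
  add_mem' ha hb w hw := by simp [ha w hw, hb w hw]
  zero_mem' w _ := by simp
  smul_mem' c v hv w hw := by simp [hv w hw]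

/-- `nabla` is the Levi-Civita connection of `g`: it is torsion free and
`w (g(X, Y)) = g(∇_w X, Y) + g(X, ∇_w Y)`. (`nabla X x w` is `∇_w X` at the point `x`.) -/
structure IsLeviCivita [FiniteDimensional ℝ E] [CompleteSpace E] [IsManifold 𝓘(ℝ, E) ∞ M]
    (g : SemiRiemannianMetric E M)
    (nabla : CovariantDerivative 𝓘(ℝ, E) E (TangentSpace 𝓘(ℝ, E) : M → Type _)) : Prop where
  torsion_eq_zero : nabla.torsion = 0
  metric (X Y : Π x : M, TangentSpace 𝓘(ℝ, E) x) (x : M)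
    (hX : MDifferentiableAt 𝓘(ℝ, E) 𝓘(ℝ, E).tangent (fun z ↦ (⟨z, X z⟩ : TangentBundle 𝓘(ℝ, E) M)) x)
    (hY : MDifferentiableAt 𝓘(ℝ, E) 𝓘(ℝ, E).tangent (fun z ↦ (⟨z, Y z⟩ : TangentBundle 𝓘(ℝ, E) M)) x)
    (w : TangentSpace 𝓘(ℝ, E) x) :
    mvfderiv 𝓘(ℝ, E) (fun z ↦ g.form z (X z) (Y z)) x w
      = g.form x (nabla X x w) (Y x) + g.form x (X x) (nabla Y x w)

/-- A `(p, q)`-metallic structure on `M`: a smooth `(1,1)`-tensor field `J` with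
`J² = p J + q I`. (Positivity of `p` and `q` is part of the structure.) -/
structure MetallicStructure (E : Type*) [NormedAddCommGroup E] [NormedSpace ℝ E]
    (M : Type*) [TopologicalSpace M] [ChartedSpace E M] [IsManifold 𝓘(ℝ, E) ∞ M] (p q : ℕ) where
  p_pos : 0 < p
  q_pos : 0 < q
  op (x : M) : TangentSpace 𝓘(ℝ, E) x →L[ℝ] TangentSpace 𝓘(ℝ, E) x
  smooth : ContMDiff 𝓘(ℝ, E) (𝓘(ℝ, E).prod 𝓘(ℝ, E →L[ℝ] E)) ∞
    (fun x ↦ TotalSpace.mk' (E →L[ℝ] E) x (op x))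
  metallic (x : M) (v : TangentSpace 𝓘(ℝ, E) x) :
    op x (op x v) = (p : ℝ) • op x v + (q : ℝ) • v

/-- `(M, g, J)` is a metallic semi-Riemannian manifold: `g` is `J`-compatible. -/
def IsMetallicSemiRiemannian [IsManifold 𝓘(ℝ, E) ∞ M] {p q : ℕ} (g : SemiRiemannianMetric E M)
    (J : MetallicStructure E M p q) : Prop :=
  ∀ (x : M) (v w : TangentSpace 𝓘(ℝ, E) x), g.form x (J.op x v) w = g.form x v (J.op x w)

/-- `J` is parallel with respect to the connection: `∇_w (J X) = J ∇_w X`. -/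
def IsParallel [IsManifold 𝓘(ℝ, E) ∞ M] {p q : ℕ}
    (nabla : CovariantDerivative 𝓘(ℝ, E) E (TangentSpace 𝓘(ℝ, E) : M → Type _))
    (J : MetallicStructure E M p q) : Prop :=
  ∀ (X : Π x : M, TangentSpace 𝓘(ℝ, E) x) (x : M),
    MDifferentiableAt 𝓘(ℝ, E) 𝓘(ℝ, E).tangent (fun z ↦ (⟨z, X z⟩ : TangentBundle 𝓘(ℝ, E) M)) x →
    ∀ w : TangentSpace 𝓘(ℝ, E) x, nabla (fun z ↦ J.op z (X z)) x w = J.op x (nabla X x w)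

/-! ### Immersed submanifolds and fields along them -/

/-- `f : N → M` is a smooth immersion (finite-dimensional manifolds without boundary). -/
structure IsSmoothImmersion (E F : Type*) [NormedAddCommGroup E] [NormedSpace ℝ E]
    [NormedAddCommGroup F] [NormedSpace ℝ F] {M N : Type*} [TopologicalSpace M] [ChartedSpace E M]
    [TopologicalSpace N] [ChartedSpace F N] (f : N → M) : Prop where
  smooth : ContMDiff 𝓘(ℝ, F) 𝓘(ℝ, E) ∞ f
  injective (y : N) : Function.Injective (mfderiv 𝓘(ℝ, F) 𝓘(ℝ, E) f y)

/-- The push-forward `f_* W`, a field along `f`, of a vector field `W` on `N`; this is how vector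
fields on `N` are viewed as sections of `TM|_N`. -/
def push (E : Type*) {F : Type*} [NormedAddCommGroup E] [NormedSpace ℝ E]
    [NormedAddCommGroup F] [NormedSpace ℝ F] {M N : Type*} [TopologicalSpace M] [ChartedSpace E M]
    [TopologicalSpace N] [ChartedSpace F N] (f : N → M)
    (W : Π y : N, TangentSpace 𝓘(ℝ, F) y) (y : N) : TangentSpace 𝓘(ℝ, E) (f y) :=
  mfderiv 𝓘(ℝ, F) 𝓘(ℝ, E) f y (W y)

/-- The tangent space of `N` at `y`, as a subspace of the tangent space of `M` at `f y`. -/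
def tangentSub (E F : Type*) [NormedAddCommGroup E] [NormedSpace ℝ E]
    [NormedAddCommGroup F] [NormedSpace ℝ F] {M N : Type*} [TopologicalSpace M] [ChartedSpace E M]
    [TopologicalSpace N] [ChartedSpace F N] (f : N → M) (y : N) :
    Submodule ℝ (TangentSpace 𝓘(ℝ, E) (f y)) :=
  LinearMap.range (mfderiv 𝓘(ℝ, F) 𝓘(ℝ, E) f y).toLinearMap

/-- The radical distribution `Rad(TN) = TN ∩ TN^⊥`. -/
def radSub (F : Type*) [NormedAddCommGroup F] [NormedSpace ℝ F]
    {N : Type*} [TopologicalSpace N] [ChartedSpace F N] [IsManifold 𝓘(ℝ, E) ∞ M] (g : SemiRiemannianMetric E M) (f : N → M) (y : N) :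
    Submodule ℝ (TangentSpace 𝓘(ℝ, E) (f y)) :=
  tangentSub E F f y ⊓ g.perp (tangentSub E F f y)

/-- A family of subspaces of `TM` along `f` is a smooth vector subbundle of `TM|_N`: near every
point it has a frame of smooth fields along `f`. -/
def IsSmoothSubbundle (F : Type*) [NormedAddCommGroup F] [NormedSpace ℝ F]
    {N : Type*} [TopologicalSpace N] [ChartedSpace F N] [IsManifold 𝓘(ℝ, E) ∞ M] (f : N → M)
    (D : Π y : N, Submodule ℝ (TangentSpace 𝓘(ℝ, E) (f y))) : Prop :=
  ∀ y₀ : N, ∃ U : Set N, IsOpen U ∧ y₀ ∈ U ∧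
    ∃ (d : ℕ) (V : Fin d → Π y : N, TangentSpace 𝓘(ℝ, E) (f y)),
      (∀ i, ContMDiffOn 𝓘(ℝ, F) 𝓘(ℝ, E).tangent ∞
        (fun y ↦ (⟨f y, V i y⟩ : TangentBundle 𝓘(ℝ, E) M)) U) ∧
      ∀ y ∈ U, LinearIndependent ℝ (fun i ↦ V i y) ∧
        Submodule.span ℝ (Set.range fun i ↦ V i y) = D y

/-- The covariant derivative `∇_w V` at `y` of a field `V` along `f : N → M` in the direction
`w ∈ T_y N`, that is, the connection induced by `nabla` on the pulled back bundle `f^* TM`.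
With respect to the frame `(E_i)` of `TM` near `f y` which is constant in the trivialization of
`TM` at `f y`, and `V = ∑ vⁱ (E_i ∘ f)` near `y`, this is `∑ dvⁱ(w) E_i + ∑ vⁱ(y) ∇_{df(w)} E_i`. -/
def covAlong [IsManifold 𝓘(ℝ, E) ∞ M]
    (nabla : CovariantDerivative 𝓘(ℝ, E) E (TangentSpace 𝓘(ℝ, E) : M → Type _)) (f : N → M)
    (V : Π y : N, TangentSpace 𝓘(ℝ, E) (f y)) (y : N) (w : TangentSpace 𝓘(ℝ, F) y) :
    TangentSpace 𝓘(ℝ, E) (f y) :=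
  let e := trivializationAt E (TangentSpace 𝓘(ℝ, E) : M → Type _) (f y)
  let v : N → E := fun z ↦ (e ⟨f z, V z⟩).2
  e.symm (f y) (mvfderiv 𝓘(ℝ, F) v y w)
    + nabla (fun x ↦ e.symm x (v y)) (f y) (mfderiv 𝓘(ℝ, F) 𝓘(ℝ, E) f y w)

/-! ### Lightlike submanifolds -/

/-- A lightlike submanifold `(N, g, S(TN), S(TN^⊥))` of `(M, g)`, immersed by `f`: the radical
distribution has constant rank `r ≥ 1`; `S(TN)` is a screen distribution, a subbundle complementary
to `Rad(TN)` in `TN`; `S(TN^⊥)` is a screen transversal bundle, complementary to `Rad(TN)` in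
`TN^⊥`; and `ltr(TN)` is a lightlike transversal bundle: it consists of null vectors, is orthogonal
to both screens, and `tr(TN) = ltr(TN) ⊕ S(TN^⊥)` is complementary to `TN` in `TM|_N`.
(The metric is automatically nondegenerate on `S(TN)` and on `S(TN^⊥)`, the sum
`TN = Rad(TN) ⊕ S(TN)` is automatically orthogonal, and `ltr(TN)` then has local frames `N_i` with
`g(ξ_i, N_j) = δ_ij`, `g(N_i, N_j) = 0` for every local frame `ξ_i` of `Rad(TN)`.) -/
structure LightlikeSubmanifold (F : Type*) [NormedAddCommGroup F] [NormedSpace ℝ F]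
    {N : Type*} [TopologicalSpace N] [ChartedSpace F N] [IsManifold 𝓘(ℝ, E) ∞ M] (g : SemiRiemannianMetric E M)
    (f : N → M) where
  immersion : IsSmoothImmersion E F f
  r : ℕ
  one_le_r : 1 ≤ r
  rank_rad (y : N) : Module.finrank ℝ (radSub F g f y) = r
  screen (y : N) : Submodule ℝ (TangentSpace 𝓘(ℝ, E) (f y))
  screenTr (y : N) : Submodule ℝ (TangentSpace 𝓘(ℝ, E) (f y))
  ltr (y : N) : Submodule ℝ (TangentSpace 𝓘(ℝ, E) (f y))
  screen_smooth : IsSmoothSubbundle F f screen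
  screenTr_smooth : IsSmoothSubbundle F f screenTr
  ltr_smooth : IsSmoothSubbundle F f ltr
  disjoint_screen (y : N) : Disjoint (radSub F g f y) (screen y)
  sup_screen (y : N) : radSub F g f y ⊔ screen y = tangentSub E F f y
  disjoint_screenTr (y : N) : Disjoint (radSub F g f y) (screenTr y)
  sup_screenTr (y : N) : radSub F g f y ⊔ screenTr y = g.perp (tangentSub E F f y)
  ltr_null (y : N) : ltr y ≤ g.perp (ltr y)
  ltr_screen (y : N) : ltr y ≤ g.perp (screen y)
  ltr_screenTr (y : N) : ltr y ≤ g.perp (screenTr y)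
  disjoint_ltr (y : N) : Disjoint (ltr y) (screenTr y)
  isCompl_tr (y : N) : IsCompl (tangentSub E F f y) (ltr y ⊔ screenTr y)

namespace LightlikeSubmanifold

variable [IsManifold 𝓘(ℝ, E) ∞ M] {g : SemiRiemannianMetric E M} {f : N → M}

theorem isCompl_screenTr (L : LightlikeSubmanifold F g f) (y : N) :
    IsCompl (L.screenTr y) (tangentSub E F f y ⊔ L.ltr y) := by
  refine IsCompl.symm ⟨?_, ?_⟩
  · exact (L.disjoint_ltr y).disjoint_sup_left_of_disjoint_sup_right (L.isCompl_tr y).disjoint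
  · rw [codisjoint_iff, sup_assoc]
    exact (L.isCompl_tr y).sup_eq_top

/-- The projection of `TM|_N = TN ⊕ tr(TN)` onto `TN`. -/
def tangentProj (L : LightlikeSubmanifold F g f) (y : N) :
    TangentSpace 𝓘(ℝ, E) (f y) →ₗ[ℝ] TangentSpace 𝓘(ℝ, E) (f y) :=
  (tangentSub E F f y).projection (L.ltr y ⊔ L.screenTr y) (L.isCompl_tr y)

/-- The projection of `TM|_N = TN ⊕ ltr(TN) ⊕ S(TN^⊥)` onto `S(TN^⊥)`. -/
def screenTrProj (L : LightlikeSubmanifold F g f) (y : N) :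
    TangentSpace 𝓘(ℝ, E) (f y) →ₗ[ℝ] TangentSpace 𝓘(ℝ, E) (f y) :=
  (L.screenTr y).projection (tangentSub E F f y ⊔ L.ltr y) (L.isCompl_screenTr y)

/-- The induced connection `∇_W U`, the tangential part of the ambient derivative (as a field
along `f` with values in `TN`). -/
def inducedConn (L : LightlikeSubmanifold F g f)
    (nabla : CovariantDerivative 𝓘(ℝ, E) E (TangentSpace 𝓘(ℝ, E) : M → Type _))
    (W U : Π y : N, TangentSpace 𝓘(ℝ, F) y) (y : N) : TangentSpace 𝓘(ℝ, E) (f y) :=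
  L.tangentProj y (covAlong nabla f (push E f U) y (W y))

/-- The screen second fundamental form `h^s(W, U)`, the `S(TN^⊥)`-part of the ambient derivative of
`U`. -/
def hs (L : LightlikeSubmanifold F g f)
    (nabla : CovariantDerivative 𝓘(ℝ, E) E (TangentSpace 𝓘(ℝ, E) : M → Type _))
    (W U : Π y : N, TangentSpace 𝓘(ℝ, F) y) (y : N) : TangentSpace 𝓘(ℝ, E) (f y) :=
  L.screenTrProj y (covAlong nabla f (push E f U) y (W y))

/-- The connection `∇^s_W Z` on `S(TN^⊥)`, the `S(TN^⊥)`-part of the ambient derivative of a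
section `Z` of `S(TN^⊥)`. -/
def nablaS (L : LightlikeSubmanifold F g f)
    (nabla : CovariantDerivative 𝓘(ℝ, E) E (TangentSpace 𝓘(ℝ, E) : M → Type _))
    (W : Π y : N, TangentSpace 𝓘(ℝ, F) y) (Z : Π y : N, TangentSpace 𝓘(ℝ, E) (f y)) (y : N) :
    TangentSpace 𝓘(ℝ, E) (f y) :=
  L.screenTrProj y (covAlong nabla f Z y (W y))

/-- `W` is a section of `Rad(TN)`: a smooth vector field on `N` with values in `Rad(TN)`. -/
def IsRadSection (_L : LightlikeSubmanifold F g f) [IsManifold 𝓘(ℝ, F) ∞ N]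
    (W : Π y : N, TangentSpace 𝓘(ℝ, F) y) : Prop :=
  ContMDiff 𝓘(ℝ, F) 𝓘(ℝ, F).tangent ∞ (fun y ↦ (⟨y, W y⟩ : TangentBundle 𝓘(ℝ, F) N)) ∧
    ∀ y, push E f W y ∈ radSub F g f y

/-- The radical distribution defines a totally geodesic foliation: it is involutive, and
`∇_W U` is a section of `Rad(TN)` for all sections `W`, `U` of `Rad(TN)`. -/
def RadTotallyGeodesicFoliation (L : LightlikeSubmanifold F g f)
    [IsManifold 𝓘(ℝ, F) ∞ N]
    (nabla : CovariantDerivative 𝓘(ℝ, E) E (TangentSpace 𝓘(ℝ, E) : M → Type _)) : Prop :=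
  (∀ W U, L.IsRadSection W → L.IsRadSection U →
    ∀ y, push E f (VectorField.mlieBracket 𝓘(ℝ, F) W U) y ∈ radSub F g f y) ∧
  ∀ W U, L.IsRadSection W → L.IsRadSection U → ∀ y, L.inducedConn nabla W U y ∈ radSub F g f y

/-- `J(S(TN))`. -/
def JScreen (L : LightlikeSubmanifold F g f) {p q : ℕ} (J : MetallicStructure E M p q)
    (y : N) : Submodule ℝ (TangentSpace 𝓘(ℝ, E) (f y)) :=
  (L.screen y).map (J.op (f y)).toLinearMap

/-- `N` is screen transversal: `J(Rad(TN)) ⊆ S(TN^⊥)`. -/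
def IsScreenTransversal (L : LightlikeSubmanifold F g f) {p q : ℕ}
    (J : MetallicStructure E M p q) : Prop :=
  ∀ y, (radSub F g f y).map (J.op (f y)).toLinearMap ≤ L.screenTr y

/-- `N` is a screen transversal anti-invariant lightlike submanifold: it is screen transversal and
`J(S(TN)) ⊆ S(TN^⊥)`. -/
structure IsScreenTransversalAntiInvariant (L : LightlikeSubmanifold F g f) {p q : ℕ}
    (J : MetallicStructure E M p q) : Prop where
  screenTransversal : L.IsScreenTransversal J
  antiInvariant (y : N) : L.JScreen J y ≤ L.screenTr y

/-- On a screen transversal anti-invariant lightlike submanifold, `J(S(TN))` is a nondegenerate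
subbundle of `S(TN^⊥)`, so it is complementary to its orthogonal complement. -/
theorem isCompl_JScreen [FiniteDimensional ℝ E] (L : LightlikeSubmanifold F g f) {p q : ℕ}
    {J : MetallicStructure E M p q} (hJ : IsMetallicSemiRiemannian g J)
    (hL : L.IsScreenTransversalAntiInvariant J) (y : N) :
    IsCompl (L.JScreen J y) (g.perp (L.JScreen J y)) := by
  let B : LinearMap.BilinForm ℝ (TangentSpace 𝓘(ℝ, E) (f y)) :=
    LinearMap.mk₂ ℝ (fun v w ↦ g.form (f y) v w) (by simp) (by simp) (by simp) (by simp)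
  have hB : B.IsRefl := fun v w h ↦ by
    simpa [B, g.symm (f y) w v] using h
  have hperp : g.perp (L.JScreen J y) = B.orthogonal (L.JScreen J y) := by
    ext v
    simp only [LinearMap.BilinForm.mem_orthogonal_iff]
    exact forall₂_congr fun w _ ↦ by
      simp [B, g.symm (f y) v w]
  have : FiniteDimensional ℝ (TangentSpace 𝓘(ℝ, E) (f y)) := ‹FiniteDimensional ℝ E›
  rw [hperp, LinearMap.BilinForm.isCompl_orthogonal_iff_disjoint hB, ← hperp,
    Submodule.disjoint_def]
  rintro _ ⟨z, hz, rfl⟩ hperpz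
  have hrad : radSub F g f y ≤ g.perp (tangentSub E F f y) := inf_le_right
  have hscr : L.screen y ≤ tangentSub E F f y := (L.sup_screen y) ▸ le_sup_right
  have htr : L.screenTr y ≤ g.perp (tangentSub E F f y) := (L.sup_screenTr y) ▸ le_sup_right
  have hq : (q : ℝ) ≠ 0 := by exact_mod_cast J.q_pos.ne'
  have hzz : ∀ w ∈ L.screen y, g.form (f y) z w = 0 := fun w hw ↦ by
    have hJw : J.op (f y) w ∈ L.JScreen J y := ⟨w, hw, rfl⟩
    have h1 : g.form (f y) (J.op (f y) z) (J.op (f y) w) = 0 := hperpz _ hJw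
    have h2 : g.form (f y) (J.op (f y) w) z = 0 :=
      htr (hL.antiInvariant y hJw) z (hscr hz)
    rw [hJ, J.metallic, map_add, map_smul, map_smul, g.symm (f y) z (J.op (f y) w), h2] at h1
    simpa [hq] using h1
  have hzrad : z ∈ radSub F g f y := by
    refine ⟨hscr hz, fun w hw ↦ ?_⟩
    rw [← L.sup_screen y] at hw
    obtain ⟨a, ha, b, hb, rfl⟩ := Submodule.mem_sup.1 hw
    rw [map_add, hzz b hb, g.symm (f y) z a, hrad ha z (hscr hz), add_zero]
  have : z = 0 := Submodule.disjoint_def.1 (L.disjoint_screen y) z hzrad hz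
  simp [this]

/-- The component in `J(S(TN))` of a vector of `S(TN^⊥)`, that is, the orthogonal projection onto
`J(S(TN))`, on a screen transversal anti-invariant lightlike submanifold. -/
def JScreenComponent [FiniteDimensional ℝ E] (L : LightlikeSubmanifold F g f) {p q : ℕ}
    {J : MetallicStructure E M p q} (hJ : IsMetallicSemiRiemannian g J)
    (hL : L.IsScreenTransversalAntiInvariant J) (y : N) :
    TangentSpace 𝓘(ℝ, E) (f y) →ₗ[ℝ] TangentSpace 𝓘(ℝ, E) (f y) :=
  (L.JScreen J y).projection (g.perp (L.JScreen J y)) (L.isCompl_JScreen hJ hL y)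

end LightlikeSubmanifold

end MetallicLightlike

end

/-! Fix sections W, U of the radical and let v be the ambient derivative of U along W at a point.
Since J is parallel, the derivative of JU is Jv (`covAlong_parallel`), so the vector in the
criterion is the S(TN^⊥)-part of Jv - pv. For s in the screen, Js lies in S(TN^⊥), and pairing with
vectors of S(TN^⊥) sees only the S(TN^⊥)-part. Self-adjointness and J² = pJ + q then give g(Jv - pv,
Js) = g(v, J²s - pJs) = q g(v, s). As q ≠ 0, the component in J(S(TN)) vanishes exactly when v is
orthogonal to the screen, which means that its tangential part is radical
(`JScreenComponent_sub_eq_zero_iff`).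

This settles the condition on the induced connection, pointwise and for each pair W, U. Involutivity
then comes for free: by `covAlong_push_sub` the bracket is the difference of two derivatives, whose
tangential parts are radical. Most of the work lies in proving the parallel and torsion-free
identities for fields along an immersion, since the hypotheses concern fields on M only; both are
computed in the trivialization at f y. -/

namespace MetallicLightlike

/-! ### Covariant derivatives in a trivialization of the tangent bundle. -/

section LocalFrame

variable {E : Type*} [NormedAddCommGroup E] [NormedSpace ℝ E]
  {M : Type*} [TopologicalSpace M] [ChartedSpace E M] [IsManifold 𝓘(ℝ, E) ∞ M]

theorem eventually_mem_baseSet_trivializationAt (x₀ : M) :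
    ∀ᶠ x in 𝓝 x₀, x ∈ (trivializationAt E (TangentSpace 𝓘(ℝ, E) : M → Type _) x₀).baseSet :=
  (trivializationAt E (TangentSpace 𝓘(ℝ, E) : M → Type _) x₀).open_baseSet.mem_nhds
    (mem_baseSet_trivializationAt E (TangentSpace 𝓘(ℝ, E) : M → Type _) x₀)

/-- A vector field with differentiable components in a trivialization is differentiable. -/
theorem mdifferentiableAt_trivializationAt_symmL {x₀ : M} {a : M → E}
    (ha : MDifferentiableAt 𝓘(ℝ, E) 𝓘(ℝ, E) a x₀) :
    MDifferentiableAt 𝓘(ℝ, E) 𝓘(ℝ, E).tangent (fun x ↦ (⟨x,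
      (trivializationAt E (TangentSpace 𝓘(ℝ, E) : M → Type _) x₀).symmL ℝ x (a x)⟩ :
        TangentBundle 𝓘(ℝ, E) M)) x₀ := by
  refine (mdifferentiableAt_section 𝓘(ℝ, E) (E := (TangentSpace 𝓘(ℝ, E) : M → Type _)) _).2
    (ha.congr_of_eventuallyEq ?_)
  filter_upwards [eventually_mem_baseSet_trivializationAt (E := E) x₀] with x hx
  rw [Trivialization.symmL_apply _ hx, Trivialization.apply_mk_symm _ hx]

/-- `covAlong` is written with the plain inverse `symm`, while the computations need linearity in
the fibre. Agreement on the base set suffices because the connection is local. -/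
theorem eventually_trivializationAt_symm_eq_symmL (x₀ : M) (a : M → E) :
    ∀ᶠ x in 𝓝 x₀, (trivializationAt E (TangentSpace 𝓘(ℝ, E) : M → Type _) x₀).symm x (a x)
      = (trivializationAt E (TangentSpace 𝓘(ℝ, E) : M → Type _) x₀).symmL ℝ x (a x) := by
  filter_upwards [eventually_mem_baseSet_trivializationAt (E := E) x₀] with x hx
  rw [Trivialization.symmL_apply _ hx]

theorem trivializationAt_self_symm_eq_symmL (x₀ : M) (c : E) :
    (trivializationAt E (TangentSpace 𝓘(ℝ, E) : M → Type _) x₀).symm x₀ c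
      = (trivializationAt E (TangentSpace 𝓘(ℝ, E) : M → Type _) x₀).symmL ℝ x₀ c :=
  (eventually_trivializationAt_symm_eq_symmL x₀ fun _ ↦ c).self_of_nhds

theorem covariantDerivative_congr
    (nabla : CovariantDerivative 𝓘(ℝ, E) E (TangentSpace 𝓘(ℝ, E) : M → Type _))
    {σ τ : Π x : M, TangentSpace 𝓘(ℝ, E) x} {x : M}
    (hσ : MDifferentiableAt 𝓘(ℝ, E) 𝓘(ℝ, E).tangent
      (fun z ↦ (⟨z, σ z⟩ : TangentBundle 𝓘(ℝ, E) M)) x)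
    (h : ∀ᶠ z in 𝓝 x, τ z = σ z) : nabla τ x = nabla σ x :=
  nabla.isCovariantDerivativeOnUniv.congr_of_eventuallyEq
    (hσ.congr_of_eventuallyEq (by filter_upwards [h] with z hz; rw [hz])) hσ Filter.univ_mem h

theorem covariantDerivative_sum
    (nabla : CovariantDerivative 𝓘(ℝ, E) E (TangentSpace 𝓘(ℝ, E) : M → Type _))
    {ι : Type*} (s : Finset ι) (σ : ι → Π x : M, TangentSpace 𝓘(ℝ, E) x) {x : M}
    (hσ : ∀ i, MDifferentiableAt 𝓘(ℝ, E) 𝓘(ℝ, E).tangent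
      (fun z ↦ (⟨z, σ i z⟩ : TangentBundle 𝓘(ℝ, E) M)) x) :
    nabla (fun z ↦ ∑ i ∈ s, σ i z) x = ∑ i ∈ s, nabla (σ i) x := by
  classical
  induction s using Finset.induction_on with
  | empty => exact congrFun nabla.zero x
  | insert i s hi ih =>
    simp only [Finset.sum_insert hi]
    rw [← ih]
    exact nabla.isCovariantDerivativeOnUniv.add (hσ i)
      (MDifferentiableAt.sum_section fun j _ ↦ hσ j)

/-- The covariant derivative of a vector field in terms of its components in a trivialization of
the tangent bundle. -/
theorem covariantDerivative_trivializationAt_symmL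
    (nabla : CovariantDerivative 𝓘(ℝ, E) E (TangentSpace 𝓘(ℝ, E) : M → Type _))
    [FiniteDimensional ℝ E] {x₀ : M} {a : M → E}
    (ha : MDifferentiableAt 𝓘(ℝ, E) 𝓘(ℝ, E) a x₀) (w : TangentSpace 𝓘(ℝ, E) x₀) :
    nabla (fun x ↦ (trivializationAt E (TangentSpace 𝓘(ℝ, E) : M → Type _) x₀).symmL ℝ x (a x)) x₀ w
      = (trivializationAt E (TangentSpace 𝓘(ℝ, E) : M → Type _) x₀).symmL ℝ x₀
          (mvfderiv 𝓘(ℝ, E) a x₀ w)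
        + nabla (fun x ↦ (trivializationAt E (TangentSpace 𝓘(ℝ, E) : M → Type _) x₀).symmL ℝ x
            (a x₀)) x₀ w := by
  set e := trivializationAt E (TangentSpace 𝓘(ℝ, E) : M → Type _) x₀
  -- The Leibniz rule takes scalar coefficients, so the E-valued component is expanded in a basis.
  let b := Module.finBasis ℝ E
  let l : Fin (Module.finrank ℝ E) → E →L[ℝ] ℝ := fun i ↦ (b.coord i).toContinuousLinearMap
  have hl : ∀ v : E, ∑ i, l i v • b i = v := b.sum_repr
  have hE : ∀ c : E, MDifferentiableAt 𝓘(ℝ, E) 𝓘(ℝ, E).tangent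
      (fun x ↦ (⟨x, e.symmL ℝ x c⟩ : TangentBundle 𝓘(ℝ, E) M)) x₀ := fun c ↦
    mdifferentiableAt_trivializationAt_symmL (a := fun _ ↦ c) mdifferentiableAt_const
  have hla : ∀ i, MDifferentiableAt 𝓘(ℝ, E) 𝓘(ℝ, ℝ) (l i ∘ a) x₀ := fun i ↦
    (l i).mdifferentiableAt.comp x₀ ha
  have hdl : ∀ i, mvfderiv 𝓘(ℝ, E) (l i ∘ a) x₀ w = l i (mvfderiv 𝓘(ℝ, E) a x₀ w) := fun i ↦ by
    have h := mfderiv_comp_apply x₀ (l i).mdifferentiableAt ha w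
    rw [(l i).mfderiv_eq] at h
    exact h
  have hexp : ∀ c : M → E, (fun x ↦ e.symmL ℝ x (c x))
      = fun x ↦ ∑ i, l i (c x) • e.symmL ℝ x (b i) := fun c ↦ by
    funext x
    conv_lhs => rw [← hl (c x)]
    simp only [map_sum, map_smul]
  -- Stated for arbitrary components so as to apply both to `a` and to the constant `a x₀`; the two
  -- expansions differ only by the terms that differentiate the coefficients.
  have key : ∀ c : M → E, (∀ i, MDifferentiableAt 𝓘(ℝ, E) 𝓘(ℝ, ℝ) (l i ∘ c) x₀) →
      nabla (fun x ↦ e.symmL ℝ x (c x)) x₀ w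
        = ∑ i, (l i (c x₀) • nabla (fun x ↦ e.symmL ℝ x (b i)) x₀ w
            + mvfderiv 𝓘(ℝ, E) (l i ∘ c) x₀ w • e.symmL ℝ x₀ (b i)) := fun c hc ↦ by
    rw [hexp, covariantDerivative_sum nabla _ (fun i x ↦ l i (c x) • e.symmL ℝ x (b i))
      fun i ↦ (hc i).smul_section (hE (b i))]
    rw [sum_apply]
    refine Finset.sum_congr rfl fun i _ ↦ ?_
    have h := nabla.isCovariantDerivativeOnUniv.leibniz (hE (b i)) (hc i)
    exact congrArg (fun T ↦ T w) h
  rw [key a hla, key (fun _ ↦ a x₀) fun i ↦ mdifferentiableAt_const, Finset.sum_add_distrib,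
    Finset.sum_add_distrib, add_comm]
  have h0 : ∀ i, mvfderiv 𝓘(ℝ, E) (l i ∘ fun _ : M ↦ a x₀) x₀ w = 0 := fun i ↦ by
    have : mvfderiv 𝓘(ℝ, E) (fun _ : M ↦ l i (a x₀)) x₀ = 0 := mvfderiv_const _
    exact congrArg (fun T ↦ T w) this
  simp only [h0, zero_smul, Finset.sum_const_zero, add_zero, hdl]
  congr 1
  conv_rhs => rw [← hl (mvfderiv 𝓘(ℝ, E) a x₀ w)]
  simp only [map_sum, map_smul]
  rfl

end LocalFrame

end MetallicLightlike

namespace MetallicLightlike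

variable {E : Type*} [NormedAddCommGroup E] [NormedSpace ℝ E]
  {F : Type*} [NormedAddCommGroup F] [NormedSpace ℝ F]
  {M : Type*} [TopologicalSpace M] [ChartedSpace E M]
  {N : Type*} [TopologicalSpace N] [ChartedSpace F N]

/-! ### Parallel tensor fields and differentiation along a map. -/

section Parallel

theorem hasMFDerivAt_clm_apply {A : N → E →L[ℝ] E} {v : N → E} {y : N}
    {A' : F →L[ℝ] E →L[ℝ] E} {v' : F →L[ℝ] E}
    (hA : HasMFDerivAt 𝓘(ℝ, F) 𝓘(ℝ, E →L[ℝ] E) A y A')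
    (hv : HasMFDerivAt 𝓘(ℝ, F) 𝓘(ℝ, E) v y v') :
    HasMFDerivAt 𝓘(ℝ, F) 𝓘(ℝ, E) (fun z ↦ A z (v z)) y
      ((A y).comp v' + A'.flip (v y) : F →L[ℝ] E) := by
  refine ⟨hA.1.clm_apply hv.1, ?_⟩
  have h := HasFDerivWithinAt.clm_apply hA.2 hv.2
  simpa [writtenInExtChartAt, Function.comp_def, chartAt_self_eq, -hasFDerivWithinAt_univ] using! h

theorem mvfderiv_clm_apply {A : N → E →L[ℝ] E} {v : N → E} {y : N}
    (hA : MDifferentiableAt 𝓘(ℝ, F) 𝓘(ℝ, E →L[ℝ] E) A y)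
    (hv : MDifferentiableAt 𝓘(ℝ, F) 𝓘(ℝ, E) v y) (w : TangentSpace 𝓘(ℝ, F) y) :
    mvfderiv 𝓘(ℝ, F) (fun z ↦ A z (v z)) y w
      = mvfderiv 𝓘(ℝ, F) A y w (v y) + A y (mvfderiv 𝓘(ℝ, F) v y w) := by
  have h := (hasMFDerivAt_clm_apply hA.hasMFDerivAt hv.hasMFDerivAt).mfderiv
  rw [add_comm]
  exact congrArg (fun T : TangentSpace 𝓘(ℝ, F) y →L[ℝ] E ↦ T w) h

theorem mvfderiv_congr {u v : N → E} {y : N} (h : ∀ᶠ z in 𝓝 y, u z = v z)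
    (w : TangentSpace 𝓘(ℝ, F) y) :
    mvfderiv 𝓘(ℝ, F) u y w = mvfderiv 𝓘(ℝ, F) v y w :=
  congrArg (fun T : TangentSpace 𝓘(ℝ, F) y →L[ℝ] E ↦ T w) (Filter.EventuallyEq.mfderiv_eq h)

variable [IsManifold 𝓘(ℝ, E) ∞ M]

theorem covAlong_eq_symmL
    (nabla : CovariantDerivative 𝓘(ℝ, E) E (TangentSpace 𝓘(ℝ, E) : M → Type _)) (f : N → M)
    (V : Π y : N, TangentSpace 𝓘(ℝ, E) (f y)) (y : N) (w : TangentSpace 𝓘(ℝ, F) y) :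
    covAlong nabla f V y w
      = (trivializationAt E (TangentSpace 𝓘(ℝ, E) : M → Type _) (f y)).symmL ℝ (f y)
          (mvfderiv 𝓘(ℝ, F) (fun z ↦ (trivializationAt E (TangentSpace 𝓘(ℝ, E) : M → Type _) (f y)
            ⟨f z, V z⟩).2) y w)
        + nabla (fun x ↦ (trivializationAt E (TangentSpace 𝓘(ℝ, E) : M → Type _) (f y)).symmL ℝ x
            (trivializationAt E (TangentSpace 𝓘(ℝ, E) : M → Type _) (f y) ⟨f y, V y⟩).2) (f y)
            (mfderiv 𝓘(ℝ, F) 𝓘(ℝ, E) f y w) := by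
  unfold covAlong
  simp only [trivializationAt_self_symm_eq_symmL]
  rw [covariantDerivative_congr nabla (mdifferentiableAt_trivializationAt_symmL
    (a := fun _ ↦ (trivializationAt E (TangentSpace 𝓘(ℝ, E) : M → Type _) (f y) ⟨f y, V y⟩).2)
    mdifferentiableAt_const) (eventually_trivializationAt_symm_eq_symmL (f y) _)]

/-- A parallel tensor field commutes with the covariant derivative along a map. -/
theorem covAlong_parallel [FiniteDimensional ℝ E] {p q : ℕ}
    (nabla : CovariantDerivative 𝓘(ℝ, E) E (TangentSpace 𝓘(ℝ, E) : M → Type _))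
    {J : MetallicStructure E M p q} (hJ : IsParallel nabla J) {f : N → M}
    {V : Π y : N, TangentSpace 𝓘(ℝ, E) (f y)} {y : N}
    (hV : MDifferentiableAt 𝓘(ℝ, F) 𝓘(ℝ, E).tangent
      (fun z ↦ (⟨f z, V z⟩ : TangentBundle 𝓘(ℝ, E) M)) y) (w : TangentSpace 𝓘(ℝ, F) y) :
    covAlong nabla f (fun z ↦ J.op (f z) (V z)) y w = J.op (f y) (covAlong nabla f V y w) := by
  obtain ⟨hf, hv⟩ := (mdifferentiableAt_totalSpace 𝓘(ℝ, E) _).1 hV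
  have hA := ((mdifferentiableAt_hom_bundle _).1
    (J.smooth.mdifferentiable (by simp) (f y))).2
  rw [covAlong_eq_symmL, covAlong_eq_symmL]
  simp only at hf hv hA
  set e := trivializationAt E (TangentSpace 𝓘(ℝ, E) : M → Type _) (f y) with he
  -- `A` is J read in the trivialization at `f y`, an operator-valued function on M.
  set A : M → E →L[ℝ] E := fun x ↦ ContinuousLinearMap.inCoordinates E
    (TangentSpace 𝓘(ℝ, E) : M → Type _) E (TangentSpace 𝓘(ℝ, E) : M → Type _)
      (f y) x (f y) x (J.op x) with hAdef
  have hmem : ∀ᶠ x in 𝓝 (f y), x ∈ e.baseSet := eventually_mem_baseSet_trivializationAt (f y)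
  have hAe : ∀ x ∈ e.baseSet, ∀ c, A x c = (e ⟨x, J.op x (e.symmL ℝ x c)⟩).2 := fun x hx c ↦
    e.continuousLinearMapAt_apply_of_mem ℝ hx _
  have hsymm : ∀ x ∈ e.baseSet, ∀ u : TangentSpace 𝓘(ℝ, E) x, e.symmL ℝ x (e ⟨x, u⟩).2 = u :=
    fun x hx u ↦ by
      rw [← e.continuousLinearMapAt_apply_of_mem ℝ hx, e.symmL_continuousLinearMapAt hx]
  have hAs : ∀ x ∈ e.baseSet, ∀ c, e.symmL ℝ x (A x c) = J.op x (e.symmL ℝ x c) :=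
    fun x hx c ↦ by rw [hAe x hx, hsymm x hx]
  have hAV : ∀ z, f z ∈ e.baseSet →
      (e ⟨f z, J.op (f z) (V z)⟩).2 = A (f z) (e ⟨f z, V z⟩).2 := fun z hz ↦ by
    rw [hAe _ hz, hsymm _ hz]
  have hy : f y ∈ e.baseSet := hmem.self_of_nhds
  have hAc : ∀ c : E, MDifferentiableAt 𝓘(ℝ, E) 𝓘(ℝ, E) (fun x ↦ A x c) (f y) := fun c ↦
    hA.clm_apply mdifferentiableAt_const
  set c : E := (e ⟨f y, V y⟩).2 with hc
  -- Product and chain rules: besides A applied to the derivative of V's components, there is a term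
  -- with the derivative of A.
  have h1 : mvfderiv 𝓘(ℝ, F) (fun z ↦ (e ⟨f z, J.op (f z) (V z)⟩).2) y w
      = mvfderiv 𝓘(ℝ, E) A (f y) (mfderiv 𝓘(ℝ, F) 𝓘(ℝ, E) f y w) c
        + A (f y) (mvfderiv 𝓘(ℝ, F) (fun z ↦ (e ⟨f z, V z⟩).2) y w) := by
    rw [mvfderiv_congr (hf.continuousAt.eventually (hmem.mono fun x hx ↦ hx) |>.mono hAV),
      mvfderiv_clm_apply (A := fun z ↦ A (f z)) (hA.comp y hf) hv]
    have h := mfderiv_comp_apply y hA hf w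
    congr 1
    exact congrArg (fun T : E →L[ℝ] E ↦ T c) h
  have h2 : mvfderiv 𝓘(ℝ, E) (fun x ↦ A x c) (f y) (mfderiv 𝓘(ℝ, F) 𝓘(ℝ, E) f y w)
      = mvfderiv 𝓘(ℝ, E) A (f y) (mfderiv 𝓘(ℝ, F) 𝓘(ℝ, E) f y w) c := by
    rw [mvfderiv_clm_apply hA mdifferentiableAt_const, mvfderiv_const]
    simp
  have h3 := covariantDerivative_trivializationAt_symmL nabla (hAc c)
    (mfderiv 𝓘(ℝ, F) 𝓘(ℝ, E) f y w)
  -- V need not extend to a field on M, so parallelism is tested on the field with constant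
  -- component c. This evaluates precisely the derivative of A left over in `h1`.
  have h4 := hJ (fun x ↦ e.symmL ℝ x c) (f y) (mdifferentiableAt_trivializationAt_symmL
    (a := fun _ ↦ c) mdifferentiableAt_const) (mfderiv 𝓘(ℝ, F) 𝓘(ℝ, E) f y w)
  rw [covariantDerivative_congr nabla (mdifferentiableAt_trivializationAt_symmL (hAc c))
    (hmem.mono fun x hx ↦ (hAs x hx c).symm), h3, h2] at h4
  rw [h1, hAV y hy, map_add, map_add, ← h4, hAs _ hy]
  abel

end Parallel

end MetallicLightlike

/-! ### Lie brackets and differentials of vector-valued functions. -/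

namespace MetallicLightlike

open VectorField in
/-- The differential of a vector-valued function `h` intertwines brackets:
`W (dh U) - U (dh W) = dh [W, U]`. -/
theorem mvfderiv_mlieBracket {E : Type*} [NormedAddCommGroup E] [NormedSpace ℝ E]
    {F : Type*} [NormedAddCommGroup F] [NormedSpace ℝ F] [CompleteSpace F]
    {N : Type*} [TopologicalSpace N] [ChartedSpace F N] [IsManifold 𝓘(ℝ, F) ∞ N]
    {h : N → E} {W U : Π y : N, TangentSpace 𝓘(ℝ, F) y} {y : N}
    (hh : ContMDiffAt 𝓘(ℝ, F) 𝓘(ℝ, E) 2 h y)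
    (hW : MDifferentiableAt 𝓘(ℝ, F) 𝓘(ℝ, F).tangent
      (fun z ↦ (⟨z, W z⟩ : TangentBundle 𝓘(ℝ, F) N)) y)
    (hU : MDifferentiableAt 𝓘(ℝ, F) 𝓘(ℝ, F).tangent
      (fun z ↦ (⟨z, U z⟩ : TangentBundle 𝓘(ℝ, F) N)) y) :
    mvfderiv 𝓘(ℝ, F) (fun z ↦ mvfderiv 𝓘(ℝ, F) h z (U z)) y (W y)
      - mvfderiv 𝓘(ℝ, F) (fun z ↦ mvfderiv 𝓘(ℝ, F) h z (W z)) y (U y)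
      = mvfderiv 𝓘(ℝ, F) h y (mlieBracket 𝓘(ℝ, F) W U y) := by
  have : IsManifold 𝓘(ℝ, F) 1 N := inferInstance
  have : IsManifold 𝓘(ℝ, F) 2 N := inferInstance
  set φ := extChartAt 𝓘(ℝ, F) y with hφ
  set x₀ : F := φ y with hx₀
  set k : F → E := h ∘ φ.symm with hk
  let hat : (Π y : N, TangentSpace 𝓘(ℝ, F) y) → F → F := fun X ↦
    mpullbackWithin 𝓘(ℝ, F) 𝓘(ℝ, F) φ.symm X (Set.range 𝓘(ℝ, F))
  have hk2 : ContDiffAt ℝ 2 k x₀ := by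
    have := (contMDiffAt_iff.1 hh).2
    simpa [hk, hφ, contDiffWithinAt_univ] using! this
  have hsource : ∀ᶠ z in 𝓝 y, z ∈ φ.source := extChartAt_source_mem_nhds y
  have hφd : ∀ z ∈ φ.source, MDifferentiableAt 𝓘(ℝ, F) 𝓘(ℝ, F) φ z := fun z hz ↦
    mdifferentiableAt_extChartAt (by simpa [hφ] using hz)
  -- The pullback inverts the differential of `φ.symm`; that inverse is the differential of φ.
  have hhat_apply : ∀ X : (Π y : N, TangentSpace 𝓘(ℝ, F) y), ∀ z ∈ φ.source,
      hat X (φ z) = mfderiv 𝓘(ℝ, F) 𝓘(ℝ, F) φ z (X z) := fun X z hz ↦ by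
    have hx := φ.map_source hz
    have h1 := isInvertible_mfderivWithin_extChartAt_symm (I := 𝓘(ℝ, F)) hx
    have h2 : hat X (φ z) = mfderiv 𝓘(ℝ, F) 𝓘(ℝ, F) φ (φ.symm (φ z)) (X (φ.symm (φ z))) := by
      have h3 := congrArg (fun T ↦ T (hat X (φ z)))
        (mfderiv_extChartAt_comp_mfderivWithin_extChartAt_symm (I := 𝓘(ℝ, F)) hx)
      refine h3.symm.trans ?_
      exact congrArg (mfderiv 𝓘(ℝ, F) 𝓘(ℝ, F) φ (φ.symm (φ z))) (h1.self_apply_inverse _)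
    rw [h2]
    exact congrArg (fun u ↦ (mfderiv 𝓘(ℝ, F) 𝓘(ℝ, F) φ u (X u) : F)) (φ.left_inv hz)
  have hhat : ∀ X : (Π y : N, TangentSpace 𝓘(ℝ, F) y),
      MDifferentiableAt 𝓘(ℝ, F) 𝓘(ℝ, F).tangent
        (fun z ↦ (⟨z, X z⟩ : TangentBundle 𝓘(ℝ, F) N)) y → DifferentiableAt ℝ (hat X) x₀ :=
    fun X hX ↦ by
      have h1 : DifferentiableWithinAt ℝ (hat X)
          (φ.symm ⁻¹' Set.univ ∩ Set.range 𝓘(ℝ, F)) x₀ :=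
        MDifferentiableWithinAt.differentiableWithinAt_mpullbackWithin_vectorField
          (mdifferentiableWithinAt_univ.2 hX)
      rwa [Set.preimage_univ, Set.univ_inter, ModelWithCorners.range_eq_univ,
        differentiableWithinAt_univ] at h1
  -- Needed on a neighbourhood, since both sides are differentiated once more.
  have hdh : ∀ᶠ z in 𝓝 y, ∀ v, mvfderiv 𝓘(ℝ, F) h z v
      = fderiv ℝ k (φ z) (mfderiv 𝓘(ℝ, F) 𝓘(ℝ, F) φ z v) := by
    have hkd : ∀ᶠ x in 𝓝 x₀, DifferentiableAt ℝ k x :=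
      (hk2.eventually (by simp)).mono fun x hx ↦ hx.differentiableAt (by simp)
    have hφc : Filter.Tendsto φ (𝓝 y) (𝓝 x₀) := continuousAt_extChartAt y
    filter_upwards [hsource.eventually_nhds, hφc.eventually hkd] with z hz hkz v
    have heq : h =ᶠ[𝓝 z] k ∘ φ := hz.mono fun u hu ↦ by simp [hk, φ.left_inv hu]
    have h1 := mfderiv_comp_apply z hkz.mdifferentiableAt (hφd z hz.self_of_nhds) v
    rw [← mfderiv_eq_fderiv]
    refine Eq.trans ?_ h1
    exact congrArg (fun T : F →L[ℝ] E ↦ T v) heq.mfderiv_eq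
  have hfd : DifferentiableAt ℝ (fderiv ℝ k) x₀ :=
    (hk2.fderiv_right (m := 1) (by norm_num)).differentiableAt (by simp)
  have key : ∀ X : (Π y : N, TangentSpace 𝓘(ℝ, F) y),
      MDifferentiableAt 𝓘(ℝ, F) 𝓘(ℝ, F).tangent
        (fun z ↦ (⟨z, X z⟩ : TangentBundle 𝓘(ℝ, F) N)) y → ∀ Y : TangentSpace 𝓘(ℝ, F) y,
      mvfderiv 𝓘(ℝ, F) (fun z ↦ mvfderiv 𝓘(ℝ, F) h z (X z)) y Y
        = fderiv ℝ k x₀ (fderiv ℝ (hat X) x₀ (mfderiv 𝓘(ℝ, F) 𝓘(ℝ, F) φ y Y))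
          + fderiv ℝ (fderiv ℝ k) x₀ (mfderiv 𝓘(ℝ, F) 𝓘(ℝ, F) φ y Y) (hat X x₀) :=
    fun X hX Y ↦ by
      have h1 := hfd.hasFDerivAt.clm_apply (hhat X hX).hasFDerivAt
      have heq : ∀ᶠ z in 𝓝 y, mvfderiv 𝓘(ℝ, F) h z (X z)
          = ((fun x ↦ fderiv ℝ k x (hat X x)) ∘ φ) z := by
        filter_upwards [hdh, hsource] with z hz hz'
        rw [hz, Function.comp_apply, hhat_apply X z hz']
      rw [mvfderiv_congr heq]
      have h2 := mfderiv_comp_apply y h1.differentiableAt.mdifferentiableAt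
        (hφd y (mem_extChartAt_source y)) Y
      refine h2.trans ?_
      exact congrArg (fun T : F →L[ℝ] E ↦ T (mfderiv 𝓘(ℝ, F) 𝓘(ℝ, F) φ y Y))
        (mfderiv_eq_fderiv.trans h1.fderiv)
  have hbr : mfderiv 𝓘(ℝ, F) 𝓘(ℝ, F) φ y (mlieBracket 𝓘(ℝ, F) W U y)
      = fderiv ℝ (hat U) x₀ (hat W x₀) - fderiv ℝ (hat W) x₀ (hat U x₀) := by
    -- The manifold bracket is the pullback of this flat bracket by the inverse of the chart
    -- differential, which applying dφ undoes.
    let B : F :=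
      lieBracketWithin ℝ (hat W) (hat U) (φ.symm ⁻¹' Set.univ ∩ Set.range 𝓘(ℝ, F)) x₀
    have h1 := (isInvertible_mfderiv_extChartAt (I := 𝓘(ℝ, F))
      (mem_extChartAt_source (I := 𝓘(ℝ, F)) y)).self_apply_inverse B
    refine Eq.trans h1 ?_
    simp [B, lieBracketWithin]
    rfl
  -- The second-derivative terms of the two expansions cancel by symmetry, leaving dk of the flat
  -- bracket.
  have hsymm : IsSymmSndFDerivAt ℝ k x₀ := hk2.isSymmSndFDerivAt (by simp)
  rw [key U hU, key W hW, hdh.self_of_nhds, hbr, ← hhat_apply W y (mem_extChartAt_source y),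
    ← hhat_apply U y (mem_extChartAt_source y), map_sub, hsymm.eq (hat W (φ y)) (hat U x₀)]
  abel

end MetallicLightlike

namespace MetallicLightlike

variable {E : Type*} [NormedAddCommGroup E] [NormedSpace ℝ E]
  {F : Type*} [NormedAddCommGroup F] [NormedSpace ℝ F]
  {M : Type*} [TopologicalSpace M] [ChartedSpace E M]
  {N : Type*} [TopologicalSpace N] [ChartedSpace F N]

/-! ### The torsion-free identity along a map. -/

section Torsion

variable [IsManifold 𝓘(ℝ, E) ∞ M]

/-- Turns components of a vector into the differential of a chart function, so that
`mvfderiv_mlieBracket` applies to them. -/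
theorem trivializationAt_apply_eq_mvfderiv {x₀ x : M}
    (hx : x ∈ (trivializationAt E (TangentSpace 𝓘(ℝ, E) : M → Type _) x₀).baseSet)
    (v : TangentSpace 𝓘(ℝ, E) x) :
    (trivializationAt E (TangentSpace 𝓘(ℝ, E) : M → Type _) x₀ ⟨x, v⟩).2
      = mvfderiv 𝓘(ℝ, E) (extChartAt 𝓘(ℝ, E) x₀) x v := by
  have : IsManifold 𝓘(ℝ, E) 1 M := inferInstance
  rw [← Trivialization.continuousLinearMapAt_apply_of_mem ℝ _ hx]
  exact congrArg (fun T : TangentSpace 𝓘(ℝ, E) x →L[ℝ] E ↦ T v)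
    (TangentBundle.continuousLinearMapAt_trivializationAt (by simpa using hx))

theorem symmL_trivializationAt_apply {x₀ x : M}
    (hx : x ∈ (trivializationAt E (TangentSpace 𝓘(ℝ, E) : M → Type _) x₀).baseSet)
    (v : TangentSpace 𝓘(ℝ, E) x) :
    (trivializationAt E (TangentSpace 𝓘(ℝ, E) : M → Type _) x₀).symmL ℝ x
      (trivializationAt E (TangentSpace 𝓘(ℝ, E) : M → Type _) x₀ ⟨x, v⟩).2 = v := by
  rw [← Trivialization.continuousLinearMapAt_apply_of_mem ℝ _ hx,
    Trivialization.symmL_continuousLinearMapAt _ hx]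

/-- Coordinate vector fields commute at the centre of the chart. -/
theorem mlieBracket_trivializationAt_symmL [CompleteSpace E] (x₀ : M) (c d : E) :
    VectorField.mlieBracket 𝓘(ℝ, E)
      (fun x ↦ (trivializationAt E (TangentSpace 𝓘(ℝ, E) : M → Type _) x₀).symmL ℝ x c)
      (fun x ↦ (trivializationAt E (TangentSpace 𝓘(ℝ, E) : M → Type _) x₀).symmL ℝ x d) x₀
      = 0 := by
  have : IsManifold 𝓘(ℝ, E) 2 M := inferInstance
  have hE : ∀ c : E, MDifferentiableAt 𝓘(ℝ, E) 𝓘(ℝ, E).tangent (fun x ↦ (⟨x,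
      (trivializationAt E (TangentSpace 𝓘(ℝ, E) : M → Type _) x₀).symmL ℝ x c⟩ :
        TangentBundle 𝓘(ℝ, E) M)) x₀ := fun c ↦
    mdifferentiableAt_trivializationAt_symmL (a := fun _ ↦ c) mdifferentiableAt_const
  have hconst : ∀ c : E, ∀ᶠ x in 𝓝 x₀, mvfderiv 𝓘(ℝ, E) (extChartAt 𝓘(ℝ, E) x₀) x
      ((trivializationAt E (TangentSpace 𝓘(ℝ, E) : M → Type _) x₀).symmL ℝ x c) = c := fun c ↦ by
    filter_upwards [eventually_mem_baseSet_trivializationAt (E := E) x₀] with x hx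
    rw [← trivializationAt_apply_eq_mvfderiv hx, Trivialization.symmL_apply _ hx,
      Trivialization.apply_mk_symm _ hx]
  -- The chart differential sends coordinate fields to constants, so it kills their bracket; being
  -- invertible at x₀, it forces the bracket to vanish.
  have h := mvfderiv_mlieBracket (h := extChartAt 𝓘(ℝ, E) x₀) (contMDiffAt_extChartAt)
    (hE c) (hE d)
  rw [mvfderiv_congr (hconst c), mvfderiv_congr (hconst d), mvfderiv_const, mvfderiv_const] at h
  have hx : x₀ ∈ (trivializationAt E (TangentSpace 𝓘(ℝ, E) : M → Type _) x₀).baseSet :=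
    mem_baseSet_trivializationAt E _ x₀
  rw [← symmL_trivializationAt_apply hx (VectorField.mlieBracket 𝓘(ℝ, E) _ _ x₀),
    trivializationAt_apply_eq_mvfderiv hx, ← h]
  simp

/-- Push-forwards of vector fields by a smooth map, differentiated with a torsion free
connection, satisfy `∇_W f_*U - ∇_U f_*W = f_*[W, U]`. -/
theorem covAlong_push_sub [FiniteDimensional ℝ E] [CompleteSpace E] [CompleteSpace F]
    [IsManifold 𝓘(ℝ, F) ∞ N]
    {nabla : CovariantDerivative 𝓘(ℝ, E) E (TangentSpace 𝓘(ℝ, E) : M → Type _)}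
    (htor : nabla.torsion = 0) {f : N → M} (hf : ContMDiff 𝓘(ℝ, F) 𝓘(ℝ, E) ∞ f)
    {W U : Π y : N, TangentSpace 𝓘(ℝ, F) y} {y : N}
    (hW : MDifferentiableAt 𝓘(ℝ, F) 𝓘(ℝ, F).tangent
      (fun z ↦ (⟨z, W z⟩ : TangentBundle 𝓘(ℝ, F) N)) y)
    (hU : MDifferentiableAt 𝓘(ℝ, F) 𝓘(ℝ, F).tangent
      (fun z ↦ (⟨z, U z⟩ : TangentBundle 𝓘(ℝ, F) N)) y) :
    covAlong nabla f (push E f U) y (W y) - covAlong nabla f (push E f W) y (U y)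
      = push E f (VectorField.mlieBracket 𝓘(ℝ, F) W U) y := by
  have : IsManifold 𝓘(ℝ, E) 2 M := inferInstance
  rw [covAlong_eq_symmL, covAlong_eq_symmL]
  have hmem : ∀ᶠ x in 𝓝 (f y),
    x ∈ (trivializationAt E (TangentSpace 𝓘(ℝ, E) : M → Type _) (f y)).baseSet :=
      eventually_mem_baseSet_trivializationAt (f y)
  have hsymm := fun v ↦ symmL_trivializationAt_apply hmem.self_of_nhds v
  have hφ : ∀ v, (trivializationAt E (TangentSpace 𝓘(ℝ, E) : M → Type _) (f y) ⟨f y, v⟩).2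
      = mvfderiv 𝓘(ℝ, E) (extChartAt 𝓘(ℝ, E) (f y)) (f y) v := fun v ↦
    trivializationAt_apply_eq_mvfderiv hmem.self_of_nhds v
  set e := trivializationAt E (TangentSpace 𝓘(ℝ, E) : M → Type _) (f y) with he
  set φ := extChartAt 𝓘(ℝ, E) (f y)
  have hφf : ContMDiffAt 𝓘(ℝ, F) 𝓘(ℝ, E) 2 (φ ∘ f) y :=
    (contMDiffAt_extChartAt (n := 2)).comp y ((hf y).of_le ENat.LEInfty.out)
  have hpush : ∀ z, f z ∈ e.baseSet → ∀ X : Π y : N, TangentSpace 𝓘(ℝ, F) y,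
      (e ⟨f z, push E f X z⟩).2 = mvfderiv 𝓘(ℝ, F) (φ ∘ f) z (X z) := fun z hz X ↦ by
    rw [trivializationAt_apply_eq_mvfderiv hz]
    exact (mfderiv_comp_apply z (mdifferentiableAt_extChartAt (by simpa [he] using hz))
      (hf.mdifferentiable (by simp) z) (X z)).symm
  have hpush' : ∀ X : Π y : N, TangentSpace 𝓘(ℝ, F) y, ∀ᶠ z in 𝓝 y,
      (e ⟨f z, push E f X z⟩).2 = mvfderiv 𝓘(ℝ, F) (φ ∘ f) z (X z) := fun X ↦
    (hf.continuous.continuousAt.eventually hmem).mono fun z hz ↦ hpush z hz X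
  rw [mvfderiv_congr (hpush' U), mvfderiv_congr (hpush' W)]
  have h1 := mvfderiv_mlieBracket hφf hW hU
  set c := (e ⟨f y, push E f U y⟩).2
  set d := (e ⟨f y, push E f W y⟩).2
  have hE : ∀ c : E, MDifferentiableAt 𝓘(ℝ, E) 𝓘(ℝ, E).tangent
      (fun x ↦ (⟨x, e.symmL ℝ x c⟩ : TangentBundle 𝓘(ℝ, E) M)) (f y) := fun c ↦
    mdifferentiableAt_trivializationAt_symmL (a := fun _ ↦ c) mdifferentiableAt_const
  -- The fields with constant components c and d commute at `f y`, so the connection terms are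
  -- symmetric and cancel. What remains is the bracket identity for `φ ∘ f`.
  have h2 := nabla.torsion_eq_zero_iff.1 htor (hE d) (hE c)
  rw [mlieBracket_trivializationAt_symmL, sub_eq_zero, hsymm, hsymm] at h2
  unfold push at h2
  rw [h2, add_sub_add_right_eq_sub, ← map_sub, h1,
    ← hpush y hmem.self_of_nhds (VectorField.mlieBracket 𝓘(ℝ, F) W U), hsymm]

end Torsion

/-! ### Pointwise linear algebra of the lightlike splitting. -/

namespace LightlikeSubmanifold

variable [IsManifold 𝓘(ℝ, E) ∞ M] {g : SemiRiemannianMetric E M} {f : N → M}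

theorem screen_le_tangentSub (L : LightlikeSubmanifold F g f) (y : N) :
    L.screen y ≤ tangentSub E F f y :=
  (L.sup_screen y) ▸ le_sup_right

theorem screenTr_le_perp (L : LightlikeSubmanifold F g f) (y : N) :
    L.screenTr y ≤ g.perp (tangentSub E F f y) :=
  (L.sup_screenTr y) ▸ le_sup_right

/-- The kernel TN ⊕ ltr(TN) of the projection is orthogonal to S(TN^⊥). -/
theorem form_screenTrProj (L : LightlikeSubmanifold F g f) (y : N)
    (v : TangentSpace 𝓘(ℝ, E) (f y)) {s : TangentSpace 𝓘(ℝ, E) (f y)} (hs : s ∈ L.screenTr y) :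
    g.form (f y) (L.screenTrProj y v) s = g.form (f y) v s := by
  have h : v - L.screenTrProj y v ∈ tangentSub E F f y ⊔ L.ltr y := by
    rw [← Submodule.projection_apply_eq_zero_iff (L.isCompl_screenTr y), map_sub, sub_eq_zero]
    exact (Submodule.projection_apply_of_mem_left _ (Submodule.projection_apply_mem _ v)).symm
  obtain ⟨t, ht, l, hl, htl⟩ := Submodule.mem_sup.1 h
  have h0 : g.form (f y) (v - L.screenTrProj y v) s = 0 := by
    rw [← htl, map_add, add_apply, g.symm (f y) t s, L.screenTr_le_perp y hs t ht,
      L.ltr_screenTr y hl s hs, add_zero]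
  rw [map_sub, sub_apply, sub_eq_zero] at h0
  exact h0.symm

/-- The kernel ltr(TN) ⊕ S(TN^⊥) is orthogonal to the screen. It is not orthogonal to the radical,
hence the restriction on s. -/
theorem form_tangentProj (L : LightlikeSubmanifold F g f) (y : N)
    (v : TangentSpace 𝓘(ℝ, E) (f y)) {s : TangentSpace 𝓘(ℝ, E) (f y)} (hs : s ∈ L.screen y) :
    g.form (f y) (L.tangentProj y v) s = g.form (f y) v s := by
  have h : v - L.tangentProj y v ∈ L.ltr y ⊔ L.screenTr y := by
    rw [← Submodule.projection_apply_eq_zero_iff (L.isCompl_tr y), map_sub, sub_eq_zero]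
    exact (Submodule.projection_apply_of_mem_left _ (Submodule.projection_apply_mem _ v)).symm
  obtain ⟨l, hl, t, ht, hlt⟩ := Submodule.mem_sup.1 h
  have h0 : g.form (f y) (v - L.tangentProj y v) s = 0 := by
    rw [← hlt, map_add, add_apply, L.ltr_screen y hl s hs,
      L.screenTr_le_perp y ht s (L.screen_le_tangentSub y hs), add_zero]
  rw [map_sub, sub_apply, sub_eq_zero] at h0
  exact h0.symm

/-- The tangential part of `v` is radical if and only if `v` is orthogonal to the screen. -/
theorem tangentProj_mem_radSub_iff (L : LightlikeSubmanifold F g f) (y : N)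
    (v : TangentSpace 𝓘(ℝ, E) (f y)) :
    L.tangentProj y v ∈ radSub F g f y ↔ ∀ s ∈ L.screen y, g.form (f y) v s = 0 := by
  have ht : L.tangentProj y v ∈ tangentSub E F f y := Submodule.projection_apply_mem _ v
  constructor
  · intro h s hs
    rw [← L.form_tangentProj y v hs]
    exact h.2 s (L.screen_le_tangentSub y hs)
  · refine fun h ↦ ⟨ht, fun w hw ↦ ?_⟩
    rw [← L.sup_screen y] at hw
    obtain ⟨a, ha, b, hb, rfl⟩ := Submodule.mem_sup.1 hw
    -- The radical summand a pairs to zero with every tangent vector, so only the screen summand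
    -- imposes a condition.
    rw [map_add, L.form_tangentProj y v hb, h b hb, g.symm, ha.2 _ ht, add_zero]

/-- `J v - p v` has no component in `J(S(TN))` if and only if the tangential part of `v` is
radical. -/
theorem JScreenComponent_sub_eq_zero_iff [FiniteDimensional ℝ E] (L : LightlikeSubmanifold F g f)
    {p q : ℕ} {J : MetallicStructure E M p q} (hJ : IsMetallicSemiRiemannian g J)
    (hL : L.IsScreenTransversalAntiInvariant J) (y : N) (v : TangentSpace 𝓘(ℝ, E) (f y)) :
    L.JScreenComponent hJ hL y (L.screenTrProj y (J.op (f y) v) - (p : ℝ) • L.screenTrProj y v) = 0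
      ↔ L.tangentProj y v ∈ radSub F g f y := by
  have hq : (q : ℝ) ≠ 0 := by exact_mod_cast J.q_pos.ne'
  -- Moving J across the metric produces J²s - pJs = qs: subtracting p times the second fundamental
  -- form is what removes the term in Js.
  have key : ∀ s ∈ L.screen y, g.form (f y)
      (L.screenTrProj y (J.op (f y) v) - (p : ℝ) • L.screenTrProj y v) (J.op (f y) s)
      = q * g.form (f y) v s := fun s hs ↦ by
    have hJs : J.op (f y) s ∈ L.screenTr y := hL.antiInvariant y ⟨s, hs, rfl⟩
    rw [map_sub, sub_apply, map_smul, smul_apply, L.form_screenTrProj y _ hJs,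
      L.form_screenTrProj y _ hJs, hJ, J.metallic, map_add, map_smul, map_smul]
    simp
  rw [JScreenComponent, Submodule.projection_apply_eq_zero_iff, L.tangentProj_mem_radSub_iff]
  constructor
  · intro h s hs
    have := h (J.op (f y) s) ⟨s, hs, rfl⟩
    rw [key s hs] at this
    exact (mul_eq_zero.1 this).resolve_left hq
  · rintro h _ ⟨s, hs, rfl⟩
    exact (key s hs).trans (by rw [h s hs, mul_zero])

end LightlikeSubmanifold

end MetallicLightlike

/-! ### Radical sections, involutivity and the main equivalence. -/

namespace MetallicLightlike.LightlikeSubmanifold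

variable {E : Type*} [NormedAddCommGroup E] [NormedSpace ℝ E]
  {F : Type*} [NormedAddCommGroup F] [NormedSpace ℝ F]
  {M : Type*} [TopologicalSpace M] [ChartedSpace E M]
  {N : Type*} [TopologicalSpace N] [ChartedSpace F N]
  [IsManifold 𝓘(ℝ, E) ∞ M] [IsManifold 𝓘(ℝ, F) ∞ N] {g : SemiRiemannianMetric E M} {f : N → M}

theorem IsRadSection.mdifferentiableAt {L : LightlikeSubmanifold F g f}
    {W : Π y : N, TangentSpace 𝓘(ℝ, F) y} (hW : L.IsRadSection W) (y : N) :
    MDifferentiableAt 𝓘(ℝ, F) 𝓘(ℝ, F).tangent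
      (fun z ↦ (⟨z, W z⟩ : TangentBundle 𝓘(ℝ, F) N)) y :=
  hW.1.mdifferentiable (by simp) y

theorem IsRadSection.mdifferentiableAt_push {L : LightlikeSubmanifold F g f}
    {W : Π y : N, TangentSpace 𝓘(ℝ, F) y} (hW : L.IsRadSection W) (y : N) :
    MDifferentiableAt 𝓘(ℝ, F) 𝓘(ℝ, E).tangent
      (fun z ↦ (⟨f z, push E f W z⟩ : TangentBundle 𝓘(ℝ, E) M)) y := by
  have : IsManifold 𝓘(ℝ, E) 1 M := inferInstance
  have : IsManifold 𝓘(ℝ, F) 1 N := inferInstance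
  -- The push-forward is the tangent map of f composed with the section; passing to the tangent map
  -- costs one derivative.
  have h := L.immersion.smooth.contMDiff_tangentMap (m := 1) 
    (by rw [one_add_one_eq_two]; exact ENat.LEInfty.out)
  exact (h.mdifferentiable one_ne_zero _).comp y (hW.mdifferentiableAt y)

/-- If the induced connection preserves the radical distribution, then the latter is involutive. -/
theorem push_mlieBracket_mem_radSub [FiniteDimensional ℝ E] [CompleteSpace E] [CompleteSpace F]
    (L : LightlikeSubmanifold F g f)
    {nabla : CovariantDerivative 𝓘(ℝ, E) E (TangentSpace 𝓘(ℝ, E) : M → Type _)}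
    (htor : nabla.torsion = 0)
    (h : ∀ W U, L.IsRadSection W → L.IsRadSection U →
      ∀ y, L.inducedConn nabla W U y ∈ radSub F g f y)
    {W U : Π y : N, TangentSpace 𝓘(ℝ, F) y} (hW : L.IsRadSection W) (hU : L.IsRadSection U)
    (y : N) : push E f (VectorField.mlieBracket 𝓘(ℝ, F) W U) y ∈ radSub F g f y := by
  have hmem : push E f (VectorField.mlieBracket 𝓘(ℝ, F) W U) y ∈ tangentSub E F f y := ⟨_, rfl⟩
  have hproj : L.tangentProj y (push E f (VectorField.mlieBracket 𝓘(ℝ, F) W U) y)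
      = push E f (VectorField.mlieBracket 𝓘(ℝ, F) W U) y :=
    Submodule.projection_apply_of_mem_left _ hmem
  rw [← hproj, ← covAlong_push_sub htor L.immersion.smooth (hW.mdifferentiableAt y)
    (hU.mdifferentiableAt y), map_sub]
  exact Submodule.sub_mem _ (h W U hW hU y) (h U W hU hW y)

end MetallicLightlike.LightlikeSubmanifold

theorem mainTheorem6
    {E : Type*} [NormedAddCommGroup E] [NormedSpace ℝ E] [FiniteDimensional ℝ E] [CompleteSpace E]
    {F : Type*} [NormedAddCommGroup F] [NormedSpace ℝ F] [FiniteDimensional ℝ F]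
    {M : Type*} [TopologicalSpace M] [T2Space M] [ChartedSpace E M] [IsManifold 𝓘(ℝ, E) ∞ M]
    {N : Type*} [TopologicalSpace N] [T2Space N] [ChartedSpace F N] [IsManifold 𝓘(ℝ, F) ∞ N]
    {p q : ℕ} (g : MetallicLightlike.SemiRiemannianMetric E M)
    (J : MetallicLightlike.MetallicStructure E M p q)
    (hJ : MetallicLightlike.IsMetallicSemiRiemannian g J)
    (nabla : CovariantDerivative 𝓘(ℝ, E) E (TangentSpace 𝓘(ℝ, E) : M → Type _))
    (hnabla : MetallicLightlike.IsLeviCivita g nabla)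
    (hparallel : MetallicLightlike.IsParallel nabla J)
    (f : N → M) (L : MetallicLightlike.LightlikeSubmanifold F g f)
    (hL : L.IsScreenTransversalAntiInvariant J) :
    L.RadTotallyGeodesicFoliation nabla ↔
      ∀ W U : (Π y : N, TangentSpace 𝓘(ℝ, F) y), L.IsRadSection W → L.IsRadSection U →
        ∀ y : N, L.JScreenComponent hJ hL y
          (L.nablaS nabla W (fun z ↦ J.op (f z) (MetallicLightlike.push E f U z)) y
            - (p : ℝ) • L.hs nabla W U y) = 0 := by
  have : CompleteSpace F := FiniteDimensional.complete ℝ F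
  have hiff : ∀ W U : (Π y : N, TangentSpace 𝓘(ℝ, F) y), L.IsRadSection W → L.IsRadSection U →
      ∀ y : N, L.JScreenComponent hJ hL y
          (L.nablaS nabla W (fun z ↦ J.op (f z) (MetallicLightlike.push E f U z)) y
            - (p : ℝ) • L.hs nabla W U y) = 0
        ↔ L.inducedConn nabla W U y ∈ MetallicLightlike.radSub F g f y := fun W U hW hU y ↦ by
    rw [MetallicLightlike.LightlikeSubmanifold.nablaS,
      MetallicLightlike.covAlong_parallel nabla hparallel (hU.mdifferentiableAt_push y)]
    -- The vector left implicit is the derivative of U, shared definitionally by `hs` and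
    -- `inducedConn`.
    exact L.JScreenComponent_sub_eq_zero_iff hJ hL y _
  constructor
  · exact fun h W U hW hU y ↦ (hiff W U hW hU y).2 (h.2 W U hW hU y)
  · intro h
    have hconn := fun W U hW hU y ↦ (hiff W U hW hU y).1 (h W U hW hU y)
    exact ⟨fun W U hW hU y ↦ L.push_mlieBracket_mem_radSub hnabla.torsion_eq_zero hconn hW hU y,
      hconn⟩
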